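/- Let $G$ be a finite group of order $N$, let $L^2(G)$ be the Hilbert space of all functions $G\to\mathbb C$ with inner product $\langle f|g\rangle=\sum_{x\in G}\overline{f(x)}\,g(x)$, and let $\widehat G$ be the set of equivalence classes of irreducible unitary representations of $G$. Then $\widehat G$ is finite. Choose a representative $\pi$ of each class in $\widehat G$ in any way; let $d(\pi)$ be its dimension and let $\pi_{ij}$, $1\le i,j\le d(\pi)$, be its matrix elements in any orthonormal basis of its representation space. For $\psi\in L^2(G)$ put $$\widehat\psi(i,j,\pi)=\sqrt{\tfrac{d(\pi)}{N}}\;\langle \pi_{ij}|\psi\rangle ,$$ and use the convention $0\log_2 0=0$. Then for every unit vector $\psi\in L^2(G)$, $$-\sum_{x\in G}|\psi(x)|^2\log_2|\psi(x)|^2-\sum_{\pi\in\widehat G}\;\sum_{1\le i,j\le d(\pi)}|\widehat\psi(i,j,\pi)|^2\log_2|\widehat\psi(i,j,\pi)|^2\;\ge\;\log_2N-\log_2\max_{\pi\in\widehat G}d(\pi).$$ If $G$ is abelian, then $d(\pi)=1$ for every $\pi\in\widehat G$, so that the left-hand side is at least $\log_2 N$ for every unit vector $\psi$; and for the unit vector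 $\psi(x)\equiv 1/\sqrt N$ equality holds. -/

import Mathlib

/-- The Shannon entropy `-∑ pₐ log₂ pₐ` (in bits) of `p` on a finite label set
(with `0 log₂ 0 = 0`). -/
noncomputable def entropyBits {α : Type*} [Fintype α] (p : α → ℝ) : ℝ :=
  -∑ a, p a * Real.logb 2 (p a)

/-- An irreducible unitary representation of `G` on the Hilbert space `ℂ^dim`.
For a finite group every irreducible unitary representation is finite-dimensional, hence
isometrically equivalent to one of this form. -/
structure UnitaryIrrep (G : Type*) [Group G] where
  /-- the dimension `d(π)` -/
  dim : ℕ
  /-- the action of the group -/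
  rep : Representation ℂ G (EuclideanSpace ℂ (Fin dim))
  unitary : ∀ (x : G) (v : EuclideanSpace ℂ (Fin dim)), ‖rep x v‖ = ‖v‖
  irreducible : rep.IsIrreducible

namespace UnitaryIrrep

/-- Equivalence of representations: existence of an invertible intertwining map. -/
instance setoid (G : Type*) [Group G] : Setoid (UnitaryIrrep G) where
  r π σ := Nonempty (π.rep.Equiv σ.rep)
  iseqv :=
    { refl := fun π => ⟨Representation.Equiv.refl π.rep⟩
      symm := fun ⟨e⟩ => ⟨e.symm⟩
      trans := fun ⟨e⟩ ⟨f⟩ => ⟨e.trans f⟩ }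

/-- The matrix element `π_ij(x) = ⟨b_i, π(x) b_j⟩` in the orthonormal basis `b`, as an element
of `L²(G)` with the inner product `⟨f, g⟩ = ∑ x, conj (f x) * g x`. -/
noncomputable def matrixElement {G : Type*} [Group G] (π : UnitaryIrrep G)
    (b : OrthonormalBasis (Fin π.dim) ℂ (EuclideanSpace ℂ (Fin π.dim)))
    (i j : Fin π.dim) : EuclideanSpace ℂ G :=
  WithLp.toLp 2 fun x => inner ℂ (b i) (π.rep x (b j))

/-- The noncommutative Fourier transform `√(d(π)/N) ⟨π_ij, ψ⟩` of `ψ` at the entry `(i, j)`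
of `π`, with `N = |G|`. -/
noncomputable def fourier {G : Type*} [Group G] [Fintype G] (π : UnitaryIrrep G)
    (b : OrthonormalBasis (Fin π.dim) ℂ (EuclideanSpace ℂ (Fin π.dim)))
    (ψ : EuclideanSpace ℂ G) (i j : Fin π.dim) : ℂ :=
  (Real.sqrt ((π.dim : ℝ) / (Fintype.card G : ℝ)) : ℂ) * inner ℂ (π.matrixElement b i j) ψ

end UnitaryIrrep

/-- The dual `Ĝ`: equivalence classes of irreducible unitary representations of `G`. -/
abbrev UnitaryDual (G : Type*) [Group G] : Type _ :=
  Quotient (UnitaryIrrep.setoid G)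

/-- The entropy of the outcome distribution `x ↦ |ψ(x)|²` on `G`. -/
noncomputable def positionEntropy {G : Type*} [Fintype G] (ψ : EuclideanSpace ℂ G) : ℝ :=
  entropyBits fun x : G => ‖ψ x‖ ^ 2

/-- The entropy of the distribution `(π, i, j) ↦ |ψ̂(i, j, π)|²`, where each class in `Ĝ` is
represented by a representation `s c` whose matrix elements are taken in the basis `b c`. -/
noncomputable def fourierEntropy {G : Type*} [Group G] [Fintype G] [Fintype (UnitaryDual G)]
    (s : UnitaryDual G → UnitaryIrrep G)
    (b : (c : UnitaryDual G) →
      OrthonormalBasis (Fin (s c).dim) ℂ (EuclideanSpace ℂ (Fin (s c).dim)))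
    (ψ : EuclideanSpace ℂ G) : ℝ :=
  entropyBits fun t : (c : UnitaryDual G) × Fin (s c).dim × Fin (s c).dim =>
    ‖(s t.1).fourier (b t.1) ψ t.2.1 t.2.2‖ ^ 2

/-! The claim is the Maassen–Uffink relation for two orthonormal bases of `L²(G)`: the point masses,
and the functions `√(d(π)/N) π_ij`, whose overlaps with point masses are at most `c = √(max d / N)`.

For that relation (`entropyBits_add_entropyBits_ge`), the coordinates `u` of `ψ` in both bases are
deformed to `u|u|ᶻ`, giving an entire function `F` with `F 0 = 1`. Cauchy–Schwarz gives `|F| ≤ 1` on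
`Re z = 0`; on `Re z = 1` the moduli `|u|²` sum to one in each basis, so `|F| ≤ c`. The three lines
theorem yields `Re F θ ≤ c ^ θ` on `(0, 1]`, with equality at `0`. Comparing derivatives there
bounds the entropies, since `F' 0` is a sum of terms `|u|² log |u|`.

That the second family is a basis is Peter–Weyl: orthonormality comes from Schur's lemma applied to
group averages of rank-one maps, and completeness from `span_fourierVector_eq_top`. -/

/-- A function that dominates another on `[0, 1]` and agrees with it at `0` has the larger derivative
there. -/
theorem HasDerivAt.le_of_le_on_Icc {f g : ℝ → ℝ} {f' g' : ℝ} (hf : HasDerivAt f f' 0)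
    (hg : HasDerivAt g g' 0) (h0 : f 0 = g 0) (h : ∀ x, 0 < x → x ≤ 1 → f x ≤ g x) : f' ≤ g' := by
  have hd := (hg.sub hf).hasDerivWithinAt (s := Set.Ioi 0)
  rw [hasDerivWithinAt_iff_tendsto_slope' (by simp)] at hd
  have : 0 ≤ g' - f' := by
    refine ge_of_tendsto hd ?_
    filter_upwards [Ioc_mem_nhdsGT (zero_lt_one (α := ℝ))] with x hx
    simp only [slope, Pi.sub_apply, h0, sub_self, sub_zero, vsub_eq_sub, smul_eq_mul]
    exact mul_nonneg (inv_nonneg.2 hx.1.le) (sub_nonneg.2 (h x hx.1 hx.2))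
  linarith

/-! ### Maassen–Uffink relation by complex interpolation. -/

section EntropicUncertainty

variable {ι κ E : Type*} [Fintype ι] [Fintype κ] [NormedAddCommGroup E] [InnerProductSpace ℂ E]

/-- The vector whose coordinates in the basis `a` are `u * |u|ᶻ`, for `u` the coordinates of `ψ`. -/
noncomputable def interpVector (a : OrthonormalBasis ι ℂ E) (ψ : E) (z : ℂ) : E :=
  ∑ i, (inner ℂ (a i) ψ * Complex.exp (z * Real.log ‖inner ℂ (a i) ψ‖)) • a i

theorem norm_mul_exp_log (u : ℂ) (z : ℂ) :
    ‖u * Complex.exp (z * Real.log ‖u‖)‖ = ‖u‖ * Real.exp (z.re * Real.log ‖u‖) := by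
  rw [norm_mul, Complex.norm_exp]
  simp

theorem norm_interpVector_le_one (a : OrthonormalBasis ι ℂ E) {ψ : E} (hψ : ‖ψ‖ = 1) {z : ℂ}
    (hz : 0 ≤ z.re) : ‖interpVector a ψ z‖ ≤ 1 := by
  have h : ‖interpVector a ψ z‖ ^ 2 ≤ 1 ^ 2 := by
    rw [← a.sum_sq_norm_inner_right, ← hψ, ← a.sum_sq_norm_inner_right ψ]
    refine Finset.sum_le_sum fun i _ => ?_
    have h1 : inner ℂ (a i) (interpVector a ψ z)
        = inner ℂ (a i) ψ * Complex.exp (z * Real.log ‖inner ℂ (a i) ψ‖) :=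
      a.orthonormal.inner_right_fintype _ i
    rw [h1, norm_mul_exp_log]
    have h2 : Real.exp (z.re * Real.log ‖inner ℂ (a i) ψ‖) ≤ 1 := by
      rw [Real.exp_le_one_iff]
      refine mul_nonpos_of_nonneg_of_nonpos hz (Real.log_nonpos (norm_nonneg _) ?_)
      calc ‖inner ℂ (a i) ψ‖ ≤ ‖a i‖ * ‖ψ‖ := norm_inner_le_norm _ _
        _ = 1 := by simp [hψ]
    gcongr
    exact mul_le_of_le_one_right (norm_nonneg _) h2
  exact (pow_le_pow_iff_left₀ (norm_nonneg _) zero_le_one two_ne_zero).1 h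

theorem sum_norm_coord_interpVector (a : OrthonormalBasis ι ℂ E) {ψ : E} (hψ : ‖ψ‖ = 1) {z : ℂ}
    (hz : z.re = 1) :
    ∑ i, ‖inner ℂ (a i) ψ * Complex.exp (z * Real.log ‖inner ℂ (a i) ψ‖)‖ = 1 := by
  have : ∑ i, ‖inner ℂ (a i) ψ‖ ^ 2 = 1 := by rw [a.sum_sq_norm_inner_right, hψ, one_pow]
  rw [← this]
  refine Finset.sum_congr rfl fun i _ => ?_
  rw [norm_mul_exp_log, hz, one_mul]
  -- At a zero coordinate `Real.log 0 = 0` makes the exponential `1`, and the prefactor still kills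
  -- the term.
  rcases eq_or_ne ‖inner ℂ (a i) ψ‖ 0 with h | h
  · simp [h]
  · rw [Real.exp_log ((norm_nonneg _).lt_of_ne' h), sq]

/-- The bilinear expression to which the three lines theorem is applied. -/
noncomputable def interpPairing (a : OrthonormalBasis ι ℂ E) (b : OrthonormalBasis κ ℂ E) (ψ : E)
    (z : ℂ) : ℂ :=
  ∑ t, ∑ x, inner ℂ ψ (b t) * Complex.exp (z * Real.log ‖inner ℂ (b t) ψ‖) *
    inner ℂ (b t) (a x) * (inner ℂ (a x) ψ * Complex.exp (z * Real.log ‖inner ℂ (a x) ψ‖))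

/-- Conjugating `z` in the antilinear slot cancels its conjugation, so the pairing is holomorphic
and still open to Cauchy–Schwarz. -/
theorem interpPairing_eq_inner (a : OrthonormalBasis ι ℂ E) (b : OrthonormalBasis κ ℂ E) (ψ : E)
    (z : ℂ) : interpPairing a b ψ z
      = inner ℂ (interpVector b ψ (starRingEnd ℂ z)) (interpVector a ψ z) := by
  simp only [interpPairing, interpVector, sum_inner, inner_sum, inner_smul_left, inner_smul_right,
    map_mul, ← Complex.exp_conj, Complex.conj_conj, Complex.conj_ofReal, inner_conj_symm,
    Finset.mul_sum]
  rw [Finset.sum_comm]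
  refine Finset.sum_congr rfl fun t _ => Finset.sum_congr rfl fun x _ => ?_
  ring

theorem norm_interpPairing_le_one (a : OrthonormalBasis ι ℂ E) (b : OrthonormalBasis κ ℂ E) {ψ : E}
    (hψ : ‖ψ‖ = 1) {z : ℂ} (hz : 0 ≤ z.re) : ‖interpPairing a b ψ z‖ ≤ 1 := by
  rw [interpPairing_eq_inner]
  refine (norm_inner_le_norm _ _).trans ?_
  exact mul_le_one₀ (norm_interpVector_le_one b hψ (by simpa using hz)) (norm_nonneg _)
    (norm_interpVector_le_one a hψ hz)

theorem norm_interpPairing_le (a : OrthonormalBasis ι ℂ E) (b : OrthonormalBasis κ ℂ E) {ψ : E}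
    (hψ : ‖ψ‖ = 1) {c : ℝ} (hc : ∀ t x, ‖inner ℂ (b t) (a x)‖ ≤ c) {z : ℂ} (hz : z.re = 1) :
    ‖interpPairing a b ψ z‖ ≤ c := by
  calc ‖interpPairing a b ψ z‖
      ≤ ∑ t, ∑ x, ‖inner ℂ (b t) ψ * Complex.exp (z * Real.log ‖inner ℂ (b t) ψ‖)‖ * c *
          ‖inner ℂ (a x) ψ * Complex.exp (z * Real.log ‖inner ℂ (a x) ψ‖)‖ := by
        refine (norm_sum_le _ _).trans (Finset.sum_le_sum fun t _ => ?_)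
        refine (norm_sum_le _ _).trans (Finset.sum_le_sum fun x _ => ?_)
        rw [norm_mul, norm_mul, norm_mul (inner ℂ ψ (b t)), norm_inner_symm, ← norm_mul]
        gcongr
        exact hc t x
    _ = c := by
        simp_rw [← Finset.mul_sum, ← Finset.sum_mul, sum_norm_coord_interpVector _ hψ hz]
        simp

theorem interpPairing_zero (a : OrthonormalBasis ι ℂ E) (b : OrthonormalBasis κ ℂ E) {ψ : E}
    (hψ : ‖ψ‖ = 1) : interpPairing a b ψ 0 = 1 := by
  rw [interpPairing_eq_inner]
  simp [interpVector, a.sum_repr', b.sum_repr', inner_self_eq_norm_sq_to_K, hψ]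

theorem hasDerivAt_interpPairing (a : OrthonormalBasis ι ℂ E) (b : OrthonormalBasis κ ℂ E) (ψ : E)
    (z : ℂ) : HasDerivAt (interpPairing a b ψ)
      (∑ t, ∑ x, inner ℂ ψ (b t) * Complex.exp (z * Real.log ‖inner ℂ (b t) ψ‖) *
        inner ℂ (b t) (a x) * (inner ℂ (a x) ψ * Complex.exp (z * Real.log ‖inner ℂ (a x) ψ‖)) *
        ((Real.log ‖inner ℂ (b t) ψ‖ : ℂ) + (Real.log ‖inner ℂ (a x) ψ‖ : ℂ))) z := by
  unfold interpPairing
  refine HasDerivAt.fun_sum fun t _ => HasDerivAt.fun_sum fun x _ => ?_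
  have he (r : ℂ) : HasDerivAt (fun z : ℂ => Complex.exp (z * r)) (Complex.exp (z * r) * r) z := by
    simpa using ((hasDerivAt_id z).mul_const r).cexp
  refine ((((he (Real.log ‖inner ℂ (b t) ψ‖)).const_mul (inner ℂ ψ (b t))).mul_const
    (inner ℂ (b t) (a x))).fun_mul
    ((he (Real.log ‖inner ℂ (a x) ψ‖)).const_mul (inner ℂ (a x) ψ))).congr_deriv ?_
  ring

/-- At `z = 0` the deformation disappears, so for each logarithm Parseval in the other basis
collapses the double sum to a single one. -/
theorem hasDerivAt_interpPairing_zero (a : OrthonormalBasis ι ℂ E) (b : OrthonormalBasis κ ℂ E)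
    (ψ : E) : HasDerivAt (interpPairing a b ψ)
      ((∑ t, ‖inner ℂ (b t) ψ‖ ^ 2 * Real.log ‖inner ℂ (b t) ψ‖ +
        ∑ x, ‖inner ℂ (a x) ψ‖ ^ 2 * Real.log ‖inner ℂ (a x) ψ‖ : ℝ) : ℂ) 0 := by
  convert hasDerivAt_interpPairing a b ψ 0 using 1
  simp only [zero_mul, Complex.exp_zero, mul_one, mul_add, Finset.sum_add_distrib]
  push_cast
  congr 1
  · refine Finset.sum_congr rfl fun t _ => ?_
    rw [← Finset.sum_mul]
    simp_rw [mul_assoc (inner ℂ ψ (b t)), ← Finset.mul_sum, a.sum_inner_mul_inner]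
    rw [← inner_conj_symm ψ, Complex.conj_mul']
  · rw [Finset.sum_comm]
    refine Finset.sum_congr rfl fun x _ => ?_
    simp_rw [← Finset.sum_mul, b.sum_inner_mul_inner]
    rw [← inner_conj_symm ψ, Complex.conj_mul']

theorem entropyBits_sq_norm {α : Type*} [Fintype α] (u : α → ℂ) :
    entropyBits (fun i => ‖u i‖ ^ 2) = -2 * (∑ i, ‖u i‖ ^ 2 * Real.log ‖u i‖) / Real.log 2 := by
  simp only [entropyBits, Real.logb, Real.log_pow, Finset.mul_sum, Finset.sum_div,
    ← Finset.sum_neg_distrib]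
  refine Finset.sum_congr rfl fun i _ => ?_
  push_cast
  ring

/-- The **Maassen–Uffink entropic uncertainty relation** for two orthonormal bases. -/
theorem entropyBits_add_entropyBits_ge (a : OrthonormalBasis ι ℂ E) (b : OrthonormalBasis κ ℂ E)
    {ψ : E} (hψ : ‖ψ‖ = 1) {c : ℝ} (hc0 : 0 < c) (hc : ∀ t x, ‖inner ℂ (b t) (a x)‖ ≤ c) :
    -2 * Real.logb 2 c ≤ entropyBits (fun x => ‖inner ℂ (a x) ψ‖ ^ 2) +
      entropyBits (fun t => ‖inner ℂ (b t) ψ‖ ^ 2) := by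
  have hbound (θ : ℝ) (h0 : 0 < θ) (h1 : θ ≤ 1) : (interpPairing a b ψ θ).re ≤ c ^ θ := by
    refine (Complex.re_le_norm _).trans ?_
    -- Edge bounds `1` and `c` interpolate to `1 ^ (1 - θ) * c ^ θ`.
    have := Complex.HadamardThreeLines.norm_le_interp_of_mem_verticalClosedStrip₀₁'
      (interpPairing a b ψ) (z := θ) (a := 1) (b := c) (by
        simp [Complex.HadamardThreeLines.verticalClosedStrip, h0.le, h1])
      (Differentiable.diffContOnCl fun z => (hasDerivAt_interpPairing a b ψ z).differentiableAt)
      ⟨1, by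
        rintro _ ⟨z, hz, rfl⟩
        exact norm_interpPairing_le_one a b hψ hz.1⟩
      (fun z hz => norm_interpPairing_le_one a b hψ (by
        simp only [Set.mem_preimage, Set.mem_singleton_iff] at hz; exact hz.ge))
      (fun z hz => norm_interpPairing_le a b hψ hc hz)
    simpa using this
  have hlog := HasDerivAt.le_of_le_on_Icc
    (hasDerivAt_interpPairing_zero a b ψ).real_of_complex
    (by simpa using (hasDerivAt_id (0 : ℝ)).const_rpow hc0)
    (by simp [interpPairing_zero a b hψ]) hbound
  rw [Complex.ofReal_re] at hlog
  rw [entropyBits_sq_norm, entropyBits_sq_norm, Real.logb, ← add_div, ← mul_div_assoc]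
  have := Real.log_pos one_lt_two
  gcongr
  linarith

end EntropicUncertainty

/-! ### Schur orthogonality and finiteness of the dual. -/

namespace UnitaryIrrep

variable {G : Type*} [Group G]

theorem inner_rep_rep (π : UnitaryIrrep G) (x : G) (v w : EuclideanSpace ℂ (Fin π.dim)) :
    inner ℂ (π.rep x v) (π.rep x w) = inner ℂ v w :=
  LinearIsometry.inner_map_map ⟨π.rep x, π.unitary x⟩ v w

theorem inner_rep_inv (π : UnitaryIrrep G) (x : G) (v w : EuclideanSpace ℂ (Fin π.dim)) :
    inner ℂ v (π.rep x⁻¹ w) = inner ℂ (π.rep x v) w := by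
  rw [← π.inner_rep_rep x, ← Module.End.mul_apply, ← map_mul, mul_inv_cancel, map_one,
    Module.End.one_apply]

theorem dim_pos (π : UnitaryIrrep G) : 0 < π.dim := by
  rw [Nat.pos_iff_ne_zero]
  intro h
  have hirr := π.irreducible
  obtain ⟨P, Q, hPQ⟩ := hirr.exists_pair_ne
  refine hPQ (Subrepresentation.toSubmodule_injective ?_)
  have : Subsingleton (EuclideanSpace ℂ (Fin π.dim)) := by
    rw [h]; infer_instance
  exact Subsingleton.elim _ _

variable [Fintype G]

/-- The group average of a linear map between two representation spaces, as an intertwining map. -/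
noncomputable def averageMap (π σ : UnitaryIrrep G)
    (A : EuclideanSpace ℂ (Fin σ.dim) →ₗ[ℂ] EuclideanSpace ℂ (Fin π.dim)) :
    Representation.IntertwiningMap σ.rep π.rep :=
  LinearMap.intertwiningMap_of_isIntertwiningMap σ.rep π.rep
    (∑ x, π.rep x⁻¹ ∘ₗ A ∘ₗ σ.rep x) fun g v => by
      simp only [LinearMap.sum_apply, LinearMap.comp_apply, map_sum]
      refine Fintype.sum_equiv (Equiv.mulRight g) _ _ fun x => ?_
      simp [← Module.End.mul_apply, ← mul_assoc, ← map_mul]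

theorem averageMap_apply (π σ : UnitaryIrrep G)
    (A : EuclideanSpace ℂ (Fin σ.dim) →ₗ[ℂ] EuclideanSpace ℂ (Fin π.dim))
    (v : EuclideanSpace ℂ (Fin σ.dim)) :
    averageMap π σ A v = ∑ x, π.rep x⁻¹ (A (σ.rep x v)) := by
  change (∑ x, π.rep x⁻¹ ∘ₗ A ∘ₗ σ.rep x) v = _
  simp

/-- Turns a sum over the group into an entry of an intertwiner, to which Schur's lemma applies. -/
theorem inner_matrixElement (π σ : UnitaryIrrep G)
    (b : OrthonormalBasis (Fin π.dim) ℂ (EuclideanSpace ℂ (Fin π.dim)))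
    (c : OrthonormalBasis (Fin σ.dim) ℂ (EuclideanSpace ℂ (Fin σ.dim)))
    (i j : Fin π.dim) (k l : Fin σ.dim) :
    inner ℂ (π.matrixElement b i j) (σ.matrixElement c k l)
      = inner ℂ (b j) (averageMap π σ (InnerProductSpace.rankOne ℂ (b i) (c k)).toLinearMap
          (c l)) := by
  rw [averageMap_apply, inner_sum, PiLp.inner_apply]
  refine Finset.sum_congr rfl fun x _ => ?_
  simp [matrixElement, inner_rep_inv, inner_smul_right]

theorem inner_matrixElement_of_not_equiv {π σ : UnitaryIrrep G}
    (h : ¬ Nonempty (σ.rep.Equiv π.rep))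
    (b : OrthonormalBasis (Fin π.dim) ℂ (EuclideanSpace ℂ (Fin π.dim)))
    (c : OrthonormalBasis (Fin σ.dim) ℂ (EuclideanSpace ℂ (Fin σ.dim)))
    (i j : Fin π.dim) (k l : Fin σ.dim) :
    inner ℂ (π.matrixElement b i j) (σ.matrixElement c k l) = 0 := by
  have h1 := π.irreducible
  have h2 := σ.irreducible
  rw [inner_matrixElement]
  set T := averageMap π σ (InnerProductSpace.rankOne ℂ (b i) (c k)).toLinearMap
  have hT : T = 0 := (Representation.IsIrreducible.bijective_or_eq_zero T).resolve_left
    fun hb => h ⟨T.ofBijective hb⟩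
  simp [hT]

/-- **Schur orthogonality** for the matrix elements of one representation. -/
theorem inner_matrixElement_self (π : UnitaryIrrep G)
    (b : OrthonormalBasis (Fin π.dim) ℂ (EuclideanSpace ℂ (Fin π.dim))) (i j k l : Fin π.dim) :
    inner ℂ (π.matrixElement b i j) (π.matrixElement b k l)
      = if i = k ∧ j = l then (Fintype.card G : ℂ) / π.dim else 0 := by
  have h1 := π.irreducible
  rw [inner_matrixElement]
  set A := (InnerProductSpace.rankOne ℂ (b i) (b k)).toLinearMap with hA
  obtain ⟨r, hr⟩ := (Representation.IsIrreducible.algebraMap_intertwiningMap_bijective_of_isAlgClosed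
    (ρ := π.rep)).2 (averageMap π π A)
  have happ (v : EuclideanSpace ℂ (Fin π.dim)) : averageMap π π A v = r • v := by
    rw [← hr]; rfl
  have hd : (π.dim : ℂ) ≠ 0 := by exact_mod_cast π.dim_pos.ne'
  -- The scalar `r` is found from the trace: averaging conjugates of `A` gives `N` times the trace
  -- of `A`, which is `⟨b_k, b_i⟩`.
  have htr : (π.dim : ℂ) * r = Fintype.card G * (if i = k then 1 else 0) := by
    calc (π.dim : ℂ) * r = ∑ m, inner ℂ (b m) (averageMap π π A (b m)) := by
          simp [happ]
      _ = ∑ x : G, ∑ m, inner ℂ (b k) (π.rep x (b m)) * inner ℂ (π.rep x (b m)) (b i) := by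
          rw [Finset.sum_comm]
          refine Finset.sum_congr rfl fun m _ => ?_
          rw [averageMap_apply, inner_sum]
          refine Finset.sum_congr rfl fun x _ => ?_
          simp [hA, inner_rep_inv, inner_smul_right]
      _ = ∑ x : G, inner ℂ (b k) (b i) := by
          refine Finset.sum_congr rfl fun x _ => ?_
          simp_rw [← inner_rep_inv]
          rw [← π.inner_rep_rep x⁻¹, ← b.sum_inner_mul_inner]
          refine Finset.sum_congr rfl fun m _ => ?_
          rw [← inv_inv x, inner_rep_inv, inv_inv]
      _ = _ := by simp [orthonormal_iff_ite.1 b.orthonormal, eq_comm]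
  have hr' : r = Fintype.card G / π.dim * (if i = k then 1 else 0) := by
    field_simp
    linear_combination htr
  rw [happ, inner_smul_right, orthonormal_iff_ite.1 b.orthonormal, hr']
  by_cases hik : i = k <;> by_cases hjl : j = l <;> simp [hik, hjl]

/-- The normalized matrix element `√(d(π)/N) π_ij`. -/
noncomputable def fourierVector (π : UnitaryIrrep G)
    (b : OrthonormalBasis (Fin π.dim) ℂ (EuclideanSpace ℂ (Fin π.dim))) (i j : Fin π.dim) :
    EuclideanSpace ℂ G :=
  (Real.sqrt ((π.dim : ℝ) / (Fintype.card G : ℝ)) : ℂ) • π.matrixElement b i j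

theorem fourier_eq_inner (π : UnitaryIrrep G)
    (b : OrthonormalBasis (Fin π.dim) ℂ (EuclideanSpace ℂ (Fin π.dim))) (ψ : EuclideanSpace ℂ G)
    (i j : Fin π.dim) : π.fourier b ψ i j = inner ℂ (π.fourierVector b i j) ψ := by
  rw [fourier, fourierVector, inner_smul_left, Complex.conj_ofReal]

theorem norm_fourierVector_apply_le (π : UnitaryIrrep G)
    (b : OrthonormalBasis (Fin π.dim) ℂ (EuclideanSpace ℂ (Fin π.dim))) (i j : Fin π.dim) (x : G) :
    ‖π.fourierVector b i j x‖ ≤ Real.sqrt ((π.dim : ℝ) / (Fintype.card G : ℝ)) := by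
  simp only [fourierVector, matrixElement, PiLp.smul_apply, norm_smul, Complex.norm_real,
    Real.norm_eq_abs, abs_of_nonneg (Real.sqrt_nonneg _)]
  refine mul_le_of_le_one_right (Real.sqrt_nonneg _) ((norm_inner_le_norm _ _).trans ?_)
  simp [π.unitary]

section Family

variable (s : UnitaryDual G → UnitaryIrrep G)
  (b : (c : UnitaryDual G) →
    OrthonormalBasis (Fin (s c).dim) ℂ (EuclideanSpace ℂ (Fin (s c).dim)))

/-- The dual is not assumed finite here, because its finiteness is deduced from this family being
linearly independent. -/
theorem orthonormal_fourierVector (hs : ∀ c, (⟦s c⟧ : UnitaryDual G) = c) :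
    Orthonormal ℂ fun t : (c : UnitaryDual G) × Fin (s c).dim × Fin (s c).dim =>
      (s t.1).fourierVector (b t.1) t.2.1 t.2.2 := by
  classical
  rw [orthonormal_iff_ite]
  rintro ⟨c, i, j⟩ ⟨c', k, l⟩
  simp only [fourierVector, inner_smul_left, inner_smul_right, Complex.conj_ofReal]
  by_cases hc : c = c'
  · subst hc
    have hd : ((s c).dim : ℂ) ≠ 0 := by exact_mod_cast (s c).dim_pos.ne'
    have hN : (Fintype.card G : ℂ) ≠ 0 := by exact_mod_cast Fintype.card_ne_zero
    have hsq : (Real.sqrt ((s c).dim / Fintype.card G) : ℂ) *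
        (Real.sqrt ((s c).dim / Fintype.card G) : ℂ) = (s c).dim / Fintype.card G := by
      rw [← Complex.ofReal_mul, Real.mul_self_sqrt (by positivity)]
      push_cast
      rfl
    rw [inner_matrixElement_self, ← mul_assoc, hsq]
    by_cases h : i = k ∧ j = l
    · obtain ⟨rfl, rfl⟩ := h
      simp only [and_self, if_true]
      field_simp
    · have h' : ¬ ((⟨c, i, j⟩ : (c : UnitaryDual G) × Fin (s c).dim × Fin (s c).dim)
          = ⟨c, k, l⟩) := by
        simpa [Sigma.mk.injEq] using h
      rw [if_neg h, if_neg h', mul_zero]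
  · rw [inner_matrixElement_of_not_equiv, mul_zero, mul_zero, if_neg]
    · simp [hc]
    · intro h
      exact hc (((hs c).symm.trans (Quotient.sound (s := setoid G) h).symm).trans (hs c'))

end Family

theorem finite_dual (G : Type*) [Group G] [Finite G] : Finite (UnitaryDual G) := by
  have := Fintype.ofFinite G
  let s : UnitaryDual G → UnitaryIrrep G := Quotient.out
  have hli := (orthonormal_fourierVector s (fun c => EuclideanSpace.basisFun _ ℂ)
    Quotient.out_eq).linearIndependent
  have := hli.finite_of_isNoetherian
  exact Finite.of_injective
    (fun c => (⟨c, ⟨0, (s c).dim_pos⟩, ⟨0, (s c).dim_pos⟩⟩ :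
      (c : UnitaryDual G) × Fin (s c).dim × Fin (s c).dim))
    fun c c' h => congrArg Sigma.fst h

end UnitaryIrrep

/-! ### Minimal subrepresentations. -/

section AtomicSubrepresentation

variable {k G V W : Type*} [Field k] [Monoid G] [AddCommGroup V] [Module k V] [AddCommGroup W]
  [Module k W] {ρ : Representation k G V} {σ : Representation k G W}

instance Subrepresentation.instIsAtomicOfFiniteDimensional [FiniteDimensional k V] :
    IsAtomic (Subrepresentation ρ) := by
  have hmono : StrictMono (Subrepresentation.toSubmodule : Subrepresentation ρ → Submodule k V) :=
    Monotone.strictMono_of_injective (fun _ _ h => h) Subrepresentation.toSubmodule_injective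
  have := hmono.wellFoundedLT
  exact isAtomic_of_orderBot_wellFounded_lt wellFounded_lt

/-- A representation that embeds onto a minimal subrepresentation is irreducible. -/
theorem Representation.isIrreducible_of_isAtom_range (T : V →ₗ[k] W) (hT : Function.Injective T)
    (hTG : ∀ g v, T (ρ g v) = σ g (T v)) {P : Subrepresentation σ} (hP : IsAtom P)
    (hrange : LinearMap.range T = P.toSubmodule) : ρ.IsIrreducible := by
  -- Pushing forward along `T` is injective and carries `⊥`, `⊤` to `⊥`, `P`; there is nothing
  -- strictly between the latter.
  let F (Q : Subrepresentation ρ) : Subrepresentation σ :=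
    ⟨Q.toSubmodule.map T, by
      rintro g _ ⟨v, hv, rfl⟩
      exact ⟨ρ g v, Q.apply_mem_toSubmodule g hv, hTG g v⟩⟩
  have hFinj : Function.Injective F := fun Q Q' h =>
    Subrepresentation.toSubmodule_injective
      (Submodule.map_injective_of_injective hT (congrArg Subrepresentation.toSubmodule h))
  have hFbot : F ⊥ = ⊥ := Subrepresentation.toSubmodule_injective (Submodule.map_bot T)
  have hFtop : F ⊤ = P := Subrepresentation.toSubmodule_injective
    ((Submodule.map_top T).trans hrange)
  refine { exists_pair_ne := ⟨⊥, ⊤, fun h => hP.1 ?_⟩, eq_bot_or_eq_top := fun Q => ?_ }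
  · rw [← hFtop, ← h, hFbot]
  · have hle : F Q ≤ P := by
      change Q.toSubmodule.map T ≤ P.toSubmodule
      rw [← hrange]
      exact LinearMap.map_le_range
    rcases hP.le_iff.1 hle with h | h
    · exact Or.inl (hFinj (h.trans hFbot.symm))
    · exact Or.inr (hFinj (h.trans hFtop.symm))

end AtomicSubrepresentation

/-! ### Completeness of the matrix elements. -/

section Completeness

variable {G : Type*} [Group G] [Fintype G]

/-- The right regular representation of `G` on `L²(G)`. -/
noncomputable def rightRegular (G : Type*) [Group G] [Fintype G] :
    Representation ℂ G (EuclideanSpace ℂ G) where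
  toFun g :=
    { toFun := fun f => WithLp.toLp 2 fun y => f (y * g)
      map_add' := fun _ _ => rfl
      map_smul' := fun _ _ => rfl }
  map_one' := by ext f y; simp
  map_mul' g h := by
    ext f y
    exact congrArg f (mul_assoc y g h).symm

@[simp]
theorem rightRegular_apply (g : G) (f : EuclideanSpace ℂ G) (y : G) :
    rightRegular G g f y = f (y * g) := rfl

theorem inner_rightRegular (g : G) (f h : EuclideanSpace ℂ G) :
    inner ℂ f (rightRegular G g h) = inner ℂ (rightRegular G g⁻¹ f) h := by
  simp only [PiLp.inner_apply, rightRegular_apply]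
  exact Fintype.sum_equiv (Equiv.mulRight g) _ _ fun x => by simp

theorem norm_rightRegular (g : G) (f : EuclideanSpace ℂ G) : ‖rightRegular G g f‖ = ‖f‖ := by
  rw [EuclideanSpace.norm_eq, EuclideanSpace.norm_eq]
  congr 1
  exact Fintype.sum_equiv (Equiv.mulRight g) _ _ fun x => by simp

namespace UnitaryIrrep

/-- Every coefficient function `x ↦ l (π(x) v)` is a combination of matrix elements. -/
theorem coefficient_mem_span (π : UnitaryIrrep G)
    (b : OrthonormalBasis (Fin π.dim) ℂ (EuclideanSpace ℂ (Fin π.dim)))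
    {M : Submodule ℂ (EuclideanSpace ℂ G)} (hM : ∀ i j, π.fourierVector b i j ∈ M)
    (l : EuclideanSpace ℂ (Fin π.dim) →ₗ[ℂ] ℂ) (v : EuclideanSpace ℂ (Fin π.dim)) :
    (WithLp.toLp 2 fun x => l (π.rep x v) : EuclideanSpace ℂ G) ∈ M := by
  have hM' (i j) : π.matrixElement b i j ∈ M := by
    have hne : (Real.sqrt ((π.dim : ℝ) / (Fintype.card G : ℝ)) : ℂ) ≠ 0 := by
      have := π.dim_pos
      rw [Complex.ofReal_ne_zero]
      positivity
    exact (M.smul_mem_iff hne).1 (hM i j)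
  have h : (WithLp.toLp 2 fun x => l (π.rep x v) : EuclideanSpace ℂ G)
      = ∑ j, ∑ i, (inner ℂ (b j) v * l (b i)) • π.matrixElement b i j := by
    ext x
    have hv : π.rep x v = ∑ j, inner ℂ (b j) v • π.rep x (b j) := by
      conv_lhs => rw [← b.sum_repr' v]
      simp
    simp only [WithLp.ofLp_sum, Finset.sum_apply, PiLp.smul_apply, matrixElement, smul_eq_mul]
    rw [hv, map_sum]
    refine Finset.sum_congr rfl fun j _ => ?_
    conv_lhs => rw [← b.sum_repr' (π.rep x (b j))]
    rw [map_smul, map_sum, smul_eq_mul, Finset.mul_sum]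
    refine Finset.sum_congr rfl fun i _ => ?_
    rw [map_smul, smul_eq_mul]
    ring
  rw [h]
  exact M.sum_mem fun j _ => M.sum_mem fun i _ => M.smul_mem _ (hM' i j)

theorem rightRegular_fourierVector_mem (π : UnitaryIrrep G)
    (b : OrthonormalBasis (Fin π.dim) ℂ (EuclideanSpace ℂ (Fin π.dim)))
    {M : Submodule ℂ (EuclideanSpace ℂ G)} (hM : ∀ i j, π.fourierVector b i j ∈ M) (g : G)
    (i j : Fin π.dim) : rightRegular G g (π.fourierVector b i j) ∈ M := by
  rw [fourierVector, map_smul]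
  refine M.smul_mem _ ?_
  convert π.coefficient_mem_span b hM (innerₛₗ ℂ (b i)) (π.rep g (b j)) using 1
  ext y
  simp [matrixElement]

/-- An irreducible unitary representation on `ℂⁿ` realized by a minimal subrepresentation of the
right regular representation. -/
theorem exists_of_isAtom {P : Subrepresentation (rightRegular G)} (hP : IsAtom P) :
    ∃ (π : UnitaryIrrep G) (T : EuclideanSpace ℂ (Fin π.dim) →ₗ[ℂ] EuclideanSpace ℂ G),
      (∀ g v, T (π.rep g v) = rightRegular G g (T v)) ∧ LinearMap.range T = P.toSubmodule := by
  let e := (stdOrthonormalBasis ℂ P.toSubmodule).repr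
  let T : EuclideanSpace ℂ (Fin (Module.finrank ℂ P.toSubmodule)) →ₗ[ℂ] EuclideanSpace ℂ G :=
    P.toSubmodule.subtype ∘ₗ e.symm.toLinearEquiv.toLinearMap
  let ρ : Representation ℂ G (EuclideanSpace ℂ (Fin (Module.finrank ℂ P.toSubmodule))) :=
    { toFun := fun g =>
        e.toLinearEquiv.toLinearMap ∘ₗ P.toRepresentation g ∘ₗ e.symm.toLinearEquiv.toLinearMap
      map_one' := by ext; simp
      map_mul' := fun g h => by ext; simp }
  have hTG (g : G) (v) : T (ρ g v) = rightRegular G g (T v) := by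
    change ((e.symm (e (P.toRepresentation g (e.symm v))) : P.toSubmodule) : EuclideanSpace ℂ G) = _
    rw [e.symm_apply_apply]
    rfl
  have hTn (v) : ‖T v‖ = ‖v‖ := e.symm.norm_map v
  have hrange : LinearMap.range T = P.toSubmodule := by
    change LinearMap.range (P.toSubmodule.subtype ∘ₗ e.symm.toLinearEquiv.toLinearMap) = _
    rw [LinearMap.range_comp_of_range_eq_top _ (LinearEquiv.range _), Submodule.range_subtype]
  exact ⟨⟨_, ρ, fun x v => by rw [← hTn, hTG, norm_rightRegular, hTn],
    Representation.isIrreducible_of_isAtom_range T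
      (Subtype.val_injective.comp e.symm.injective) hTG hP hrange⟩, T, hTG, hrange⟩

variable (s : UnitaryDual G → UnitaryIrrep G)
  (b : (c : UnitaryDual G) →
    OrthonormalBasis (Fin (s c).dim) ℂ (EuclideanSpace ℂ (Fin (s c).dim)))

/-- Completeness of the matrix elements in `L²(G)`. -/
theorem span_fourierVector_eq_top (hs : ∀ c, (⟦s c⟧ : UnitaryDual G) = c) :
    Submodule.span ℂ (Set.range fun t : (c : UnitaryDual G) × Fin (s c).dim × Fin (s c).dim =>
      (s t.1).fourierVector (b t.1) t.2.1 t.2.2) = ⊤ := by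
  set M := Submodule.span ℂ (Set.range fun t : (c : UnitaryDual G) × Fin (s c).dim × Fin (s c).dim =>
      (s t.1).fourierVector (b t.1) t.2.1 t.2.2) with hMdef
  have hM (c) (i j) : (s c).fourierVector (b c) i j ∈ M := Submodule.subset_span ⟨⟨c, i, j⟩, rfl⟩
  have hMinv (g : G) : ∀ f ∈ M, rightRegular G g f ∈ M := by
    have : M ≤ M.comap (rightRegular G g) := by
      rw [hMdef, Submodule.span_le]
      rintro _ ⟨t, rfl⟩
      exact rightRegular_fourierVector_mem _ _ (hM t.1) g _ _
    exact this
  -- The orthogonal complement of the invariant space `M` is invariant; if nonzero, it contains a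
  -- minimal subrepresentation `P`.
  let K : Subrepresentation (rightRegular G) := ⟨Mᗮ, fun g f hf => by
    rw [Submodule.mem_orthogonal] at hf ⊢
    intro u hu
    rw [inner_rightRegular]
    exact hf _ (hMinv _ u hu)⟩
  rw [← Submodule.orthogonal_eq_bot_iff]
  rcases eq_bot_or_exists_atom_le K with h | ⟨P, hP, hPK⟩
  · exact congrArg Subrepresentation.toSubmodule h
  exfalso
  obtain ⟨π, T, hTG, hrange⟩ := exists_of_isAtom hP
  obtain ⟨φ⟩ : Nonempty ((s ⟦π⟧).rep.Equiv π.rep) := Quotient.exact (hs ⟦π⟧)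
  refine hP.1 (Subrepresentation.toSubmodule_injective ((Submodule.eq_bot_iff _).2 fun f hf => ?_))
  have hfK : f ∈ Mᗮ := hPK hf
  have hfM : f ∈ M := by
    obtain ⟨w, rfl⟩ : f ∈ LinearMap.range T := hrange ▸ hf
    -- Any `f` in `P` is a coefficient function, because `f x` is the value at `1` of the right
    -- translate of `f` by `x`. Hence `f` lies in both `M` and `Mᗮ`.
    let l : EuclideanSpace ℂ (Fin (s ⟦π⟧).dim) →ₗ[ℂ] ℂ :=
      (EuclideanSpace.proj (𝕜 := ℂ) (1 : G)).toLinearMap ∘ₗ T ∘ₗ φ.toLinearEquiv.toLinearMap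
    convert (s ⟦π⟧).coefficient_mem_span (b ⟦π⟧) (hM ⟦π⟧) l (φ.symm w) using 1
    ext x
    change T w x = T (φ ((s ⟦π⟧).rep x (φ.symm w))) 1
    have : φ ((s ⟦π⟧).rep x (φ.symm w)) = π.rep x w := by
      have := φ.toIntertwiningMap.isIntertwining _ _ x (φ.symm w)
      simpa using this
    rw [this, hTG, rightRegular_apply, one_mul]
  exact inner_self_eq_zero.1 ((Submodule.mem_orthogonal _ _).1 hfK f hfM)

/-- The normalized matrix elements as an orthonormal basis of `L²(G)`. -/
noncomputable def fourierBasis [Fintype (UnitaryDual G)]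
    (hs : ∀ c, (⟦s c⟧ : UnitaryDual G) = c) :
    OrthonormalBasis ((c : UnitaryDual G) × Fin (s c).dim × Fin (s c).dim) ℂ (EuclideanSpace ℂ G) :=
  OrthonormalBasis.mk (orthonormal_fourierVector s b hs) (span_fourierVector_eq_top s b hs).ge

theorem fourierBasis_apply [Fintype (UnitaryDual G)] (hs : ∀ c, (⟦s c⟧ : UnitaryDual G) = c)
    (t : (c : UnitaryDual G) × Fin (s c).dim × Fin (s c).dim) :
    fourierBasis s b hs t = (s t.1).fourierVector (b t.1) t.2.1 t.2.2 := by
  simp [fourierBasis]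

end UnitaryIrrep

end Completeness

/-! ### The uncertainty relation on a group, and equality in the abelian case. -/

namespace UnitaryIrrep

variable {G : Type*} [Group G]

theorem dim_eq_one_of_commute (hG : ∀ x y : G, x * y = y * x) (π : UnitaryIrrep G) :
    π.dim = 1 := by
  have := π.irreducible
  have : IsMulCommutative G := ⟨⟨hG⟩⟩
  simpa using Representation.IsIrreducible.finrank_eq_one_of_isMulCommutative π.rep

variable [Fintype G]

/-- The entropic uncertainty relation on a finite group. -/
theorem entropy_uncertainty [Fintype (UnitaryDual G)] (s : UnitaryDual G → UnitaryIrrep G)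
    (hs : ∀ c, (⟦s c⟧ : UnitaryDual G) = c)
    (b : (c : UnitaryDual G) →
      OrthonormalBasis (Fin (s c).dim) ℂ (EuclideanSpace ℂ (Fin (s c).dim)))
    {ψ : EuclideanSpace ℂ G} (hψ : ‖ψ‖ = 1) {D : ℕ} (hD0 : 0 < D) (hD : ∀ c, (s c).dim ≤ D) :
    Real.logb 2 (Fintype.card G : ℝ) - Real.logb 2 (D : ℝ)
      ≤ positionEntropy ψ + fourierEntropy s b ψ := by
  classical
  have hN : (0 : ℝ) < Fintype.card G := by exact_mod_cast Fintype.card_pos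
  have hD' : (0 : ℝ) < D := by exact_mod_cast hD0
  have h := entropyBits_add_entropyBits_ge (EuclideanSpace.basisFun G ℂ) (fourierBasis s b hs) hψ
    (c := Real.sqrt (D / Fintype.card G)) (by positivity) fun t x => by
      rw [fourierBasis_apply, EuclideanSpace.basisFun_apply, norm_inner_symm,
        EuclideanSpace.inner_single_left, map_one, one_mul]
      refine (norm_fourierVector_apply_le _ _ _ _ x).trans ?_
      gcongr
      exact hD t.1
  have hlog : -2 * Real.logb 2 (Real.sqrt (D / Fintype.card G))
      = Real.logb 2 (Fintype.card G : ℝ) - Real.logb 2 (D : ℝ) := by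
    rw [Real.logb, Real.log_sqrt (by positivity), Real.log_div hD'.ne' hN.ne', Real.logb, Real.logb]
    ring
  rw [hlog] at h
  simpa [positionEntropy, fourierEntropy, fourier_eq_inner, fourierBasis_apply,
    EuclideanSpace.inner_single_left] using h

theorem positionEntropy_const {ψ : EuclideanSpace ℂ G}
    (h : ∀ x, ψ x = 1 / (Real.sqrt (Fintype.card G : ℝ) : ℂ)) :
    positionEntropy ψ = Real.logb 2 (Fintype.card G : ℝ) := by
  have hN : (Fintype.card G : ℝ) ≠ 0 := by exact_mod_cast Fintype.card_ne_zero
  have hn (x : G) : ‖ψ x‖ ^ 2 = (Fintype.card G : ℝ)⁻¹ := by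
    rw [h x]
    simp
  simp only [positionEntropy, entropyBits, hn, Real.logb_inv]
  simp [hN]

theorem norm_const {ψ : EuclideanSpace ℂ G}
    (h : ∀ x, ψ x = 1 / (Real.sqrt (Fintype.card G : ℝ) : ℂ)) : ‖ψ‖ = 1 := by
  rw [EuclideanSpace.norm_eq]
  simp [h]

/-- The Fourier coefficient of the constant unit vector at a one-dimensional representation has
modulus `0` or `1`. -/
theorem norm_fourier_const (π : UnitaryIrrep G) (hπ : π.dim = 1)
    (b : OrthonormalBasis (Fin π.dim) ℂ (EuclideanSpace ℂ (Fin π.dim))) {ψ : EuclideanSpace ℂ G}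
    (h : ∀ x, ψ x = 1 / (Real.sqrt (Fintype.card G : ℝ) : ℂ)) (i j : Fin π.dim) :
    ‖π.fourier b ψ i j‖ = 0 ∨ ‖π.fourier b ψ i j‖ = 1 := by
  have : Subsingleton (Fin π.dim) := by rw [hπ]; infer_instance
  obtain rfl : i = j := Subsingleton.elim _ _
  let χ : G → ℂ := fun x => inner ℂ (b i) (π.rep x (b i))
  have hmul (x g : G) : χ (x * g) = χ x * χ g := by
    have hg : π.rep g (b i) = χ g • b i := by
      conv_lhs => rw [← b.sum_repr' (π.rep g (b i))]
      rw [Fintype.sum_eq_single i fun k hk => (hk (Subsingleton.elim _ _)).elim]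
    change inner ℂ (b i) (π.rep (x * g) (b i)) = _
    rw [map_mul, Module.End.mul_apply, hg, map_smul, inner_smul_right, mul_comm]
  have hN : (Fintype.card G : ℝ) ≠ 0 := by exact_mod_cast Fintype.card_ne_zero
  -- Translation invariance of the character sum: either it vanishes or the character is trivial.
  have hS (g : G) : (∑ x, χ x) * χ g = ∑ x, χ x := by
    rw [Finset.sum_mul]
    exact Fintype.sum_equiv (Equiv.mulRight g) _ _ fun x => (hmul x g).symm
  have hval : ‖π.fourier b ψ i i‖ = ‖∑ x, χ x‖ / Fintype.card G := by
    have h1 : inner ℂ (π.matrixElement b i i) ψ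
        = 1 / (Real.sqrt (Fintype.card G : ℝ) : ℂ) * starRingEnd ℂ (∑ x, χ x) := by
      rw [PiLp.inner_apply, map_sum, Finset.mul_sum]
      refine Finset.sum_congr rfl fun x _ => ?_
      rw [h x, RCLike.inner_apply]
      rfl
    rw [fourier, h1, hπ, norm_mul, norm_mul, RCLike.norm_conj, norm_div, norm_one,
      Complex.norm_real, Complex.norm_real, Real.norm_of_nonneg (Real.sqrt_nonneg _),
      Real.norm_of_nonneg (Real.sqrt_nonneg _), Nat.cast_one, Real.sqrt_div zero_le_one,
      Real.sqrt_one, ← mul_assoc, div_mul_div_comm, Real.mul_self_sqrt (Nat.cast_nonneg _)]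
    ring
  rw [hval]
  by_cases h0 : ∑ x, χ x = 0
  · left
    simp [h0]
  · right
    have h1 (g : G) : χ g = 1 := mul_left_cancel₀ h0 ((hS g).trans (mul_one _).symm)
    simp [h1, hN]

/-- Every probability is `0` or `1`, so each term `p log p` vanishes; which one is `1` does not
matter. -/
theorem fourierEntropy_const [Fintype (UnitaryDual G)] (s : UnitaryDual G → UnitaryIrrep G)
    (hdim : ∀ c, (s c).dim = 1)
    (b : (c : UnitaryDual G) →
      OrthonormalBasis (Fin (s c).dim) ℂ (EuclideanSpace ℂ (Fin (s c).dim)))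
    {ψ : EuclideanSpace ℂ G} (h : ∀ x, ψ x = 1 / (Real.sqrt (Fintype.card G : ℝ) : ℂ)) :
    fourierEntropy s b ψ = 0 := by
  rw [fourierEntropy, entropyBits, Finset.sum_eq_zero, neg_zero]
  intro t _
  rcases norm_fourier_const (s t.1) (hdim t.1) (b t.1) h t.2.1 t.2.2 with h | h <;> simp [h]

end UnitaryIrrep

theorem mainTheorem6 (G : Type*) [Group G] [Fintype G] :
    ∃ _ : Fintype (UnitaryDual G),
      ∀ (s : UnitaryDual G → UnitaryIrrep G) (_ : ∀ c, (⟦s c⟧ : UnitaryDual G) = c)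
        (b : (c : UnitaryDual G) →
          OrthonormalBasis (Fin (s c).dim) ℂ (EuclideanSpace ℂ (Fin (s c).dim))),
        (∀ ψ : EuclideanSpace ℂ G, ‖ψ‖ = 1 →
          Real.logb 2 (Fintype.card G : ℝ)
              - Real.logb 2 ((Finset.univ.sup fun c => (s c).dim : ℕ) : ℝ)
            ≤ positionEntropy ψ + fourierEntropy s b ψ) ∧
        ((∀ x y : G, x * y = y * x) →
          (∀ c, (s c).dim = 1) ∧
          (∀ ψ : EuclideanSpace ℂ G, ‖ψ‖ = 1 →
            Real.logb 2 (Fintype.card G : ℝ) ≤ positionEntropy ψ + fourierEntropy s b ψ) ∧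
          (∀ ψ : EuclideanSpace ℂ G, (∀ x, ψ x = 1 / (Real.sqrt (Fintype.card G : ℝ) : ℂ)) →
            ‖ψ‖ = 1 ∧
            positionEntropy ψ + fourierEntropy s b ψ
              = Real.logb 2 (Fintype.card G : ℝ))) := by
  have := UnitaryIrrep.finite_dual G
  refine ⟨Fintype.ofFinite _, fun s hs b => ?_⟩
  let := Fintype.ofFinite (UnitaryDual G)
  refine ⟨fun ψ hψ => ?_, fun hG => ?_⟩
  · have hle (c : UnitaryDual G) : (s c).dim ≤ Finset.univ.sup fun c => (s c).dim :=
      Finset.le_sup (f := fun c => (s c).dim) (Finset.mem_univ c)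
    -- A supremum over an empty dual would be `0`; a unit vector forces the Fourier basis to be
    -- nonempty, so the maximal dimension is positive.
    have : Nonempty ((c : UnitaryDual G) × Fin (s c).dim × Fin (s c).dim) := by
      rw [← not_isEmpty_iff]
      intro hempty
      have hz : ‖ψ‖ ^ 2 = 0 := by
        rw [← (UnitaryIrrep.fourierBasis s b hs).sum_sq_norm_inner_right, Fintype.sum_empty]
      simp [hψ] at hz
    obtain ⟨c, _⟩ := this
    exact UnitaryIrrep.entropy_uncertainty s hs b hψ ((s c).dim_pos.trans_le (hle c)) hle
  · have hdim (c : UnitaryDual G) : (s c).dim = 1 := UnitaryIrrep.dim_eq_one_of_commute hG _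
    refine ⟨hdim, fun ψ hψ => ?_, fun ψ hψ => ⟨UnitaryIrrep.norm_const hψ, ?_⟩⟩
    · simpa using UnitaryIrrep.entropy_uncertainty s hs b hψ one_pos fun c => (hdim c).le
    · rw [UnitaryIrrep.positionEntropy_const hψ, UnitaryIrrep.fourierEntropy_const s hdim b hψ,
        add_zero]
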